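/- **Model.** For a directed graph $G$ on $n$ vertices (self-loops allowed, no parallel edges) in which every out-degree $\deg(i)$ is at least $1$, the PageRank of $G$ with jumping probability $\epsilon\in(0,1)$ is the stationary distribution $\pi$ of the Markov chain with transition matrix $M_{ij}=\frac{\epsilon}{n}+\frac{1-\epsilon}{\deg(i)}$ if $(i,j)$ is an edge and $M_{ij}=\frac{\epsilon}{n}$ otherwise. An $\alpha$-additive approximation of it is a vector $\tilde\pi\in\mathbb{R}^n$ with $\|\tilde\pi-\pi\|_1\le\alpha$. An algorithm *explicitly maintains* an $\alpha$-additive approximation on an initial graph and a sequence of edge updates if it stores a vector $\tilde\pi$, one memory cell per entry, that is an $\alpha$-additive approximation of the PageRank of the current graph initially and after each update has been processed. In one unit of time an algorithm may do arbitrary internal computation, but it can rewrite at most one entry of $\tilde\pi$; its total time is the number of time units spent on processing all updates (the preparation of the initial memory contents is not charged). **Theorem.** There are absolute constants $c>0$ and $C$ such that the following holds. Fix $\epsilon\in(0.01,0.99)$, and let $\alpha=\alpha(n)$ satisfy $0<\alpha\le(1-\epsilon)^6/101$ for all large $n$, and $1/\alpha=n^{o(1/\log\log n)}$. Then for all sufficiently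 large $n$ there are an initial graph $G_0$ on $n$ vertices, with all out-degrees at least $1$, and a sequence $e_1,\dots,e_k$ of distinct edges not in $G_0$, with $|E(G_0)|+k\le Cn$, such that 1. (incremental) every algorithm that explicitly maintains an $\alpha$-additive approximation of PageRank while $e_1,\dots,e_k$ are inserted one by one into $G_0$, and 2. (decremental) every algorithm that explicitly maintains an $\alpha$-additive approximation of PageRank while $e_k,\dots,e_1$ are deleted one by one from $G_0+\{e_1,\dots,e_k\}$ has total time at least $n\cdot(1/\alpha)^{c\log\log n}$. -/

import Mathlib

open Filter Asymptotics Topology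

namespace DynPageRank

/-- A directed graph on the vertex set `Fin n` (self-loops allowed, no parallel edges),
given by its edge set. -/
abbrev Graph (n : ℕ) := Finset (Fin n × Fin n)

/-- Out-degree of the vertex `v`. -/
def outDeg {n : ℕ} (G : Graph n) (v : Fin n) : ℕ := (G.filter fun e => e.1 = v).card

/-- The transition matrix of the random walk on `G` that jumps to a uniformly random vertex
with probability `ε`, and otherwise follows a uniformly random outgoing edge. -/
noncomputable def transition {n : ℕ} (ε : ℝ) (G : Graph n) : Matrix (Fin n) (Fin n) ℝ :=
  Matrix.of fun i j => if (i, j) ∈ G then ε / n + (1 - ε) * (1 / (outDeg G i : ℝ)) else ε / n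

/-- `p` is the PageRank of `G` with jumping probability `ε`: the stationary distribution of the
random walk. For `0 < ε < 1`, `1 ≤ n` and all out-degrees positive there is exactly one. -/
def IsPageRank {n : ℕ} (ε : ℝ) (G : Graph n) (p : Fin n → ℝ) : Prop :=
  (∀ v, 0 ≤ p v) ∧ ∑ v, p v = 1 ∧ Matrix.vecMul p (transition ε G) = p

/-- `q` is an `α`-additive approximation of the PageRank of `G`: its `L₁` distance from the
PageRank vector is at most `α`. -/
def IsAdditiveApprox {n : ℕ} (ε α : ℝ) (G : Graph n) (q : Fin n → ℝ) : Prop :=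
  ∃ p, IsPageRank ε G p ∧ ∑ v, |q v - p v| ≤ α

/-- A single edge update. -/
inductive Update (n : ℕ) where
  | ins (e : Fin n × Fin n) : Update n
  | del (e : Fin n × Fin n) : Update n

/-- The graph after an update. -/
def Update.apply {n : ℕ} : Update n → Graph n → Graph n
  | .ins e, G => insert e G
  | .del e, G => G.erase e

/-- The memory of an algorithm: the explicitly stored vector `out`, one cell per vertex, and
everything else (`state`). -/
structure Config (n : ℕ) (State : Type) where
  state : State
  out : Fin n → ℝ

/-- An algorithm on graphs with `n` vertices that explicitly stores a vector. Its internal state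
space is arbitrary. It starts from any configuration, which may depend on the initial graph;
an update is handed over through `receive`; it is then processed by repeating `step`.
One step takes one unit of time: it may read the whole memory, changes the internal state in an
arbitrary way, and rewrites at most one entry of the stored vector. The value `none` of `step`
means that the processing of the current update is finished. In particular all RAM algorithms
that write one cell per step and keep every entry of the vector in a cell of its own are covered,
as are the runs of a randomized algorithm (its random bits being part of the state). -/
structure Algorithm (n : ℕ) where
  State : Type
  start : Graph n → Config n State
  receive : Update n → State → State
  step : Config n State → Option (State × Option (Fin n × ℝ))

/-- Perform at most one write in the stored vector. -/
def write {n : ℕ} : Option (Fin n × ℝ) → (Fin n → ℝ) → (Fin n → ℝ)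
  | none, q => q
  | some (v, x), q => Function.update q v x

/-- `A.Halts c k c'`: from configuration `c` the algorithm performs exactly `k` steps and then
stops, in configuration `c'`. -/
inductive Algorithm.Halts {n : ℕ} (A : Algorithm n) :
    Config n A.State → ℕ → Config n A.State → Prop where
  | done (c : Config n A.State) (h : A.step c = none) : A.Halts c 0 c
  | more (c : Config n A.State) (s : A.State) (w : Option (Fin n × ℝ)) (k : ℕ)
      (c' : Config n A.State) (h : A.step c = some (s, w))
      (hr : A.Halts ⟨s, write w c.out⟩ k c') : A.Halts c (k + 1) c'

/-- `A.MaintainsFrom ε α G c us T`: started in configuration `c` with current graph `G`, the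
algorithm processes the updates `us` one after the other; the stored vector is an `α`-additive
approximation of the PageRank of the current graph at the beginning and after each update; and
the total number of steps is `T`. -/
inductive Algorithm.MaintainsFrom {n : ℕ} (A : Algorithm n) (ε α : ℝ) :
    Graph n → Config n A.State → List (Update n) → ℕ → Prop where
  | nil (G : Graph n) (c : Config n A.State) (h : IsAdditiveApprox ε α G c.out) :
      A.MaintainsFrom ε α G c [] 0
  | cons (G : Graph n) (c c' : Config n A.State) (u : Update n) (us : List (Update n)) (k T : ℕ)
      (h : IsAdditiveApprox ε α G c.out)
      (hk : A.Halts ⟨A.receive u c.state, c.out⟩ k c')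
      (hT : A.MaintainsFrom ε α (u.apply G) c' us T) :
      A.MaintainsFrom ε α G c (u :: us) (k + T)

/-- On the initial graph `G` and the update sequence `us`, the algorithm explicitly maintains an
`α`-additive approximation of PageRank, and takes total time `T` to process the updates
(the time for preparing the initial configuration is not charged). -/
def Algorithm.MaintainsInTime {n : ℕ} (A : Algorithm n) (ε α : ℝ) (G : Graph n)
    (us : List (Update n)) (T : ℕ) : Prop :=
  A.MaintainsFrom ε α G (A.start G) us T

end DynPageRank

namespace DynPageRank

section

variable {n : ℕ}

/-- The graph after a list of updates. -/
def applyUpdates : List (Update n) → Graph n → Graph n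
  | [], G => G
  | u :: us, G => applyUpdates us (u.apply G)

theorem applyUpdates_map_ins (l : List (Fin n × Fin n)) (G : Graph n) :
    applyUpdates (l.map Update.ins) G = G ∪ l.toFinset := by
  induction l generalizing G with
  | nil => simp [applyUpdates]
  | cons e l ih =>
    simp only [List.map_cons, applyUpdates, ih, Update.apply]
    ext x; simp

theorem applyUpdates_map_del (l : List (Fin n × Fin n)) (G : Graph n) :
    applyUpdates (l.map Update.del) G = G \ l.toFinset := by
  induction l generalizing G with
  | nil => simp [applyUpdates]
  | cons e l ih =>
    simp only [List.map_cons, applyUpdates, ih, Update.apply]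
    ext x; simp; tauto

/-- The number of entries in which two vectors differ. -/
noncomputable def diffCount (q q' : Fin n → ℝ) : ℕ := (Finset.univ.filter fun v => q v ≠ q' v).card

theorem diffCount_self (q : Fin n → ℝ) : diffCount q q = 0 := by simp [diffCount]

theorem diffCount_comm (q q' : Fin n → ℝ) : diffCount q q' = diffCount q' q := by
  simp [diffCount, ne_comm]

theorem diffCount_triangle (q₁ q₂ q₃ : Fin n → ℝ) :
    diffCount q₁ q₃ ≤ diffCount q₁ q₂ + diffCount q₂ q₃ := by
  classical
  refine le_trans (Finset.card_le_card ?_) (Finset.card_union_le _ _)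
  intro v hv
  simp only [Finset.mem_filter, Finset.mem_univ, true_and, Finset.mem_union] at hv ⊢
  by_contra! h
  exact hv (h.1.trans h.2)

theorem diffCount_write_le_one (w : Option (Fin n × ℝ)) (q : Fin n → ℝ) :
    diffCount q (write w q) ≤ 1 := by
  cases w with
  | none => simp [write, diffCount_self]
  | some vx =>
    refine le_trans (Finset.card_le_card (t := {vx.1}) ?_) (by simp)
    intro v hv
    by_contra h
    simp only [Finset.mem_singleton] at h
    exact (Finset.mem_filter.1 hv).2 (by simp [write, Function.update_of_ne h])

theorem Algorithm.Halts.diffCount_le {A : Algorithm n} {c c' : Config n A.State} {k : ℕ}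
    (h : A.Halts c k c') : diffCount c.out c'.out ≤ k := by
  induction h with
  | done c h => simp [diffCount_self]
  | more c s w k c' h hr ih =>
    have h1 := diffCount_triangle c.out (write w c.out) c'.out
    have h2 := diffCount_write_le_one w c.out
    simp only at ih
    omega

theorem Algorithm.MaintainsFrom.isAdditiveApprox {A : Algorithm n} {ε α : ℝ} {G : Graph n}
    {c : Config n A.State} {us : List (Update n)} {T : ℕ} (h : A.MaintainsFrom ε α G c us T) :
    IsAdditiveApprox ε α G c.out := by
  cases h <;> assumption

theorem Algorithm.MaintainsFrom.append {A : Algorithm n} {ε α : ℝ} (us us' : List (Update n))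
    {G : Graph n} {c : Config n A.State} {T : ℕ} (h : A.MaintainsFrom ε α G c (us ++ us') T) :
    ∃ (c' : Config n A.State) (T₁ T₂ : ℕ), T₁ + T₂ = T ∧ diffCount c.out c'.out ≤ T₁ ∧
      A.MaintainsFrom ε α (applyUpdates us G) c' us' T₂ := by
  induction us generalizing G c T with
  | nil => exact ⟨c, 0, T, by simp, by simp [diffCount_self], h⟩
  | cons u us ih =>
    cases h with
    | cons _ _ c₁ _ _ k T' h hk hT =>
      obtain ⟨c', T₁, T₂, hsum, hd, hm⟩ := ih hT
      refine ⟨c', k + T₁, T₂, by omega, ?_, hm⟩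
      have h1 := hk.diffCount_le
      have h2 := diffCount_triangle c.out c₁.out c'.out
      simp only at h1
      omega

/-- The edges that a sequence of graphs gains in step `t`. -/
noncomputable def newEdges (G : ℕ → Graph n) (t : ℕ) : List (Fin n × Fin n) :=
  (G (t + 1) \ G t).toList

theorem toFinset_newEdges (G : ℕ → Graph n) (t : ℕ) :
    (newEdges G t).toFinset = G (t + 1) \ G t := by simp [newEdges]

/-- All edges that a sequence of graphs gains in the first `P` steps, in order. -/
noncomputable def edgeSeq (G : ℕ → Graph n) (P : ℕ) : List (Fin n × Fin n) :=
  (List.range P).flatMap (newEdges G)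

theorem edgeSeq_succ (G : ℕ → Graph n) (P : ℕ) :
    edgeSeq G (P + 1) = edgeSeq G P ++ newEdges G P := by
  simp [edgeSeq, List.range_succ]

theorem toFinset_edgeSeq {G : ℕ → Graph n} (hG : Monotone G) (P : ℕ) :
    (edgeSeq G P).toFinset = G P \ G 0 := by
  induction P with
  | zero => simp [edgeSeq]
  | succ P ih =>
    rw [edgeSeq_succ, List.toFinset_append, ih, toFinset_newEdges]
    have h1 := hG (Nat.zero_le P)
    have h2 := hG (Nat.le_succ P)
    ext x
    have h1 := @h1 x
    have h2 := @h2 x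
    simp only [Finset.mem_union, Finset.mem_sdiff]
    simp only [Nat.succ_eq_add_one] at h2
    tauto

theorem nodup_edgeSeq {G : ℕ → Graph n} (hG : Monotone G) (P : ℕ) : (edgeSeq G P).Nodup := by
  induction P with
  | zero => simp [edgeSeq]
  | succ P ih =>
    rw [edgeSeq_succ]
    refine ih.append (Finset.nodup_toList _) ?_
    intro x hx hx'
    rw [← List.mem_toFinset, toFinset_edgeSeq hG] at hx
    rw [← List.mem_toFinset, toFinset_newEdges] at hx'
    simp only [Finset.mem_sdiff] at hx hx'
    exact hx'.2 hx.1

theorem sum_le_of_maintains_insertions {A : Algorithm n} {ε α : ℝ} {G : ℕ → Graph n}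
    (hG : Monotone G) (R : ℕ → ℕ) (k : ℕ) {P : ℕ}
    (hR : ∀ t < P, ∀ q q', IsAdditiveApprox ε α (G t) q → IsAdditiveApprox ε α (G (t + 1)) q' →
      R t ≤ diffCount q q') (s : ℕ) (hs : s + k = P) {c : Config n A.State} {T : ℕ}
    (h : A.MaintainsFrom ε α (G s) c
      (((List.range' s k).flatMap (newEdges G)).map Update.ins) T) :
    ∑ t ∈ Finset.Ico s P, R t ≤ T := by
  induction k generalizing s c T with
  | zero => simp [← hs]
  | succ k ih =>
    rw [List.range'_succ, List.flatMap_cons, List.map_append] at h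
    obtain ⟨c', T₁, T₂, hsum, hd, hm⟩ := h.append
    rw [applyUpdates_map_ins, toFinset_newEdges,
      Finset.union_sdiff_of_subset (hG (Nat.le_succ s))] at hm
    rw [Finset.sum_eq_sum_Ico_succ_bot (by omega)]
    have h1 := ih (s + 1) (by omega) hm
    have h2 := hR s (by omega) _ _ h.isAdditiveApprox hm.isAdditiveApprox
    omega

theorem sum_le_of_maintains_deletions {A : Algorithm n} {ε α : ℝ} {G : ℕ → Graph n}
    (hG : Monotone G) (R : ℕ → ℕ) {P : ℕ}
    (hR : ∀ t < P, ∀ q q', IsAdditiveApprox ε α (G t) q → IsAdditiveApprox ε α (G (t + 1)) q' →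
      R t ≤ diffCount q q') {c : Config n A.State} {T : ℕ}
    (h : A.MaintainsFrom ε α (G P) c ((edgeSeq G P).reverse.map Update.del) T) :
    ∑ t ∈ Finset.range P, R t ≤ T := by
  induction P generalizing c T with
  | zero => simp
  | succ P ih =>
    rw [edgeSeq_succ, List.reverse_append, List.map_append] at h
    obtain ⟨c', T₁, T₂, hsum, hd, hm⟩ := h.append
    rw [applyUpdates_map_del, List.toFinset_reverse, toFinset_newEdges,
      sdiff_sdiff_right_self, inf_eq_right.2 (hG (Nat.le_succ P))] at hm
    rw [Finset.sum_range_succ]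
    have h1 := ih (fun t ht => hR t (by omega)) hm
    have h2 := hR P (by omega) _ _ hm.isAdditiveApprox h.isAdditiveApprox
    rw [diffCount_comm] at h2
    omega

theorem IsPageRank.apply_eq {ε : ℝ} {G : Graph n} {p : Fin n → ℝ} (hp : IsPageRank ε G p)
    (v : Fin n) :
    p v = ε / n + (1 - ε) * ∑ u, if (u, v) ∈ G then p u / outDeg G u else 0 := by
  obtain ⟨-, hsum, hst⟩ := hp
  have h := congrFun hst v
  rw [← h]
  simp only [Matrix.vecMul, dotProduct, transition, Matrix.of_apply]
  rw [Finset.mul_sum]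
  calc _ = ∑ u, (p u * (ε / n) + (1 - ε) * if (u, v) ∈ G then p u / outDeg G u else 0) := by
        refine Finset.sum_congr rfl fun u _ => ?_
        split_ifs <;> ring
    _ = _ := by rw [Finset.sum_add_distrib, ← Finset.sum_mul, hsum, one_mul]

theorem le_diffCount_of_forall_add_le {ε α δ : ℝ} {G G' : Graph n} {q q' : Fin n → ℝ}
    (B : Finset (Fin n)) (R : ℕ) (hB : 2 * R = B.card) (hδ : 0 ≤ δ) (hα : 4 * α < B.card * δ)
    (h : ∀ p p', IsPageRank ε G p → IsPageRank ε G' p' → ∀ v ∈ B, p' v + δ ≤ p v)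
    (hq : IsAdditiveApprox ε α G q) (hq' : IsAdditiveApprox ε α G' q') : R ≤ diffCount q q' := by
  obtain ⟨p, hp, hqp⟩ := hq
  obtain ⟨p', hp', hqp'⟩ := hq'
  by_contra! hlt
  set U := B.filter fun v => q v = q' v with hU
  have hcard : R ≤ U.card := by
    have h1 : (B.filter fun v => ¬ q v = q' v).card ≤ diffCount q q' :=
      Finset.card_le_card (Finset.filter_subset_filter _ (Finset.subset_univ _))
    have h2 := Finset.card_filter_add_card_filter_not (s := B) fun v => q v = q' v
    rw [← hU] at h2
    omega
  have h1 : ∑ v ∈ U, δ ≤ ∑ v ∈ U, (|q v - p v| + |q' v - p' v|) := by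
    refine Finset.sum_le_sum fun v hv => ?_
    simp only [hU, Finset.mem_filter] at hv
    have h2 := h p p' hp hp' v hv.1
    have h3 := neg_abs_le (q v - p v)
    have h4 := le_abs_self (q' v - p' v)
    have h5 := hv.2
    linarith
  have h2 : ∑ v ∈ U, (|q v - p v| + |q' v - p' v|) ≤
      ∑ v, (|q v - p v| + |q' v - p' v|) :=
    Finset.sum_le_sum_of_subset_of_nonneg (Finset.subset_univ _) fun _ _ _ => by positivity
  rw [Finset.sum_add_distrib (s := Finset.univ)] at h2
  rw [Finset.sum_const, nsmul_eq_mul] at h1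
  have h3 : (R : ℝ) * δ ≤ U.card * δ := by gcongr
  have h4 : (B.card : ℝ) = 2 * R := by rw [← hB]; push_cast; ring
  rw [h4] at hα
  linarith

end

/-- In the tree in which the node `(h, y)` of height `h` has the parent `(h + 1, y / L)`: the
out-degree at time `τ` of the node `(h + 1, z)`. Its child `(h, y)` is reached through
`2 ^ (y % L)` parallel links, which are present from time `y * L ^ h + 1` on. -/
def branchDeg (L P τ h z : ℕ) : ℕ :=
  1 + ∑ y ∈ Finset.range P, if y / L = z ∧ y * L ^ h < τ then 2 ^ (y % L) else 0

theorem branchDeg_pos (L P τ h z : ℕ) : 0 < branchDeg L P τ h z := by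
  unfold branchDeg; omega

theorem branchDeg_mono (L P h z : ℕ) {τ τ' : ℕ} (hτ : τ ≤ τ') :
    branchDeg L P τ h z ≤ branchDeg L P τ' h z := by
  unfold branchDeg
  gcongr with y _
  split_ifs with h1 h2
  · rfl
  · exact absurd ⟨h1.1, h1.2.trans_le hτ⟩ h2
  · exact Nat.zero_le _
  · rfl

theorem mul_pow_lt_succ_iff {L : ℕ} (hL : 0 < L) (y h t : ℕ) :
    y * L ^ h < t + 1 ↔ y ≤ t / L ^ h := by
  rw [Nat.lt_succ_iff, Nat.le_div_iff_mul_le (by positivity)]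

theorem branchDeg_active {L P t : ℕ} (hL : 0 < L) (ht : t < P) (h : ℕ) :
    branchDeg L P (t + 1) h (t / L ^ (h + 1)) = 2 ^ (t / L ^ h % L + 1) := by
  set x := t / L ^ h with hx
  have hz : t / L ^ (h + 1) = x / L := by rw [hx, Nat.div_div_eq_div_mul, pow_succ]
  have hxP : x < P := (Nat.div_le_self _ _).trans_lt ht
  unfold branchDeg
  rw [hz, ← Finset.sum_filter]
  have himg : (Finset.range P).filter (fun y => y / L = x / L ∧ y * L ^ h < t + 1) =
      (Finset.range (x % L + 1)).image fun i => L * (x / L) + i := by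
    ext y
    simp only [Finset.mem_filter, Finset.mem_range, Finset.mem_image, mul_pow_lt_succ_iff hL]
    rw [← hx]
    have hxd := Nat.div_add_mod x L
    constructor
    · rintro ⟨-, h1, h2⟩
      have hyd := Nat.div_add_mod y L
      rw [h1] at hyd
      exact ⟨y % L, by omega, hyd⟩
    · rintro ⟨i, hi, rfl⟩
      have hiL : i < L := by have := Nat.mod_lt x hL; omega
      refine ⟨by omega, ?_, by omega⟩
      rw [Nat.mul_add_div hL, Nat.div_eq_of_lt hiL, add_zero]
  rw [himg, Finset.sum_image (by intro a _ b _ h; simpa using h)]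
  have : ∀ i ∈ Finset.range (x % L + 1), 2 ^ ((L * (x / L) + i) % L) = 2 ^ i := by
    intro i hi
    rw [Finset.mem_range] at hi
    rw [Nat.mul_add_mod, Nat.mod_eq_of_lt (by have := Nat.mod_lt x hL; omega)]
  rw [Finset.sum_congr rfl this, Nat.geomSum_eq le_rfl]
  have := Nat.one_le_two_pow (n := x % L + 1)
  simp
  omega

theorem succ_div_pow_eq {L t : ℕ} (h : (t + 1) / L = t / L) (k : ℕ) :
    (t + 1) / L ^ (k + 1) = t / L ^ (k + 1) := by
  rw [pow_succ', ← Nat.div_div_eq_div_mul, ← Nat.div_div_eq_div_mul, h]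

/-- The equations for the masses `X h y` of the nodes `(h, y)` of the tree at time `τ`. -/
def TreeFlow (L D : ℕ) (κ γ : ℝ) (τ : ℕ) (X : ℕ → ℕ → ℝ) : Prop :=
  ∀ h < D, ∀ y < L ^ D, X h y = κ + γ *
    if y * L ^ h < τ then 2 ^ (y % L) * X (h + 1) (y / L) / branchDeg L (L ^ D) τ h (y / L) else 0

theorem TreeFlow.eq_of_same_block {L D t : ℕ} {κ γ : ℝ} {X X' : ℕ → ℕ → ℝ} (hL : 0 < L)
    (hX : TreeFlow L D κ γ (t + 1) X) (hX' : TreeFlow L D κ γ (t + 2) X')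
    (htL : (t + 1) / L = t / L) (hroot : ∀ y < L ^ D, X D y = X' D y) (k : ℕ) :
    ∀ h, h + 1 + k = D → ∀ y < L ^ D, X (h + 1) y = X' (h + 1) y := by
  induction k with
  | zero => intro h hh; rw [add_zero] at hh; rw [hh]; exact hroot
  | succ k ih =>
    intro h hh y hy
    have hiff : ∀ y, y * L ^ (h + 1) < t + 1 ↔ y * L ^ (h + 1) < t + 2 := fun y => by
      rw [mul_pow_lt_succ_iff hL, mul_pow_lt_succ_iff hL, succ_div_pow_eq htL]
    have hdeg : ∀ z, branchDeg L (L ^ D) (t + 1) (h + 1) z =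
        branchDeg L (L ^ D) (t + 2) (h + 1) z := fun z => by simp only [branchDeg, hiff]
    rw [hX (h + 1) (by omega) y hy, hX' (h + 1) (by omega) y hy, hdeg,
      ih (h + 1) (by omega) (y / L) ((Nat.div_le_self _ _).trans_lt hy)]
    simp only [hiff]

theorem TreeFlow.pow_mul_le_active {L D t : ℕ} {κ γ : ℝ} {X : ℕ → ℕ → ℝ} (hL : 0 < L)
    (hX : TreeFlow L D κ γ (t + 1) X) (hκ : 0 ≤ κ) (hγ : 0 ≤ γ) (ht : t < L ^ D) (k : ℕ) :
    ∀ h, h + k = D → (γ / 2) ^ k * X D 0 ≤ X h (t / L ^ h) := by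
  induction k with
  | zero =>
    intro h hh
    rw [add_zero] at hh
    subst hh
    rw [Nat.div_eq_of_lt ht]; simp
  | succ k ih =>
    intro h hh
    have h1 := ih (h + 1) (by omega)
    have h2 := hX h (by omega) (t / L ^ h) ((Nat.div_le_self _ _).trans_lt ht)
    have hz : t / L ^ h / L = t / L ^ (h + 1) := by rw [Nat.div_div_eq_div_mul, pow_succ]
    rw [if_pos ((mul_pow_lt_succ_iff hL _ _ _).2 le_rfl), hz, branchDeg_active hL ht] at h2
    rw [h2, pow_succ']
    have h3 : γ * (2 ^ (t / L ^ h % L) * X (h + 1) (t / L ^ (h + 1)) /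
        ((2 ^ (t / L ^ h % L + 1) : ℕ) : ℝ)) = γ / 2 * X (h + 1) (t / L ^ (h + 1)) := by
      push_cast; rw [pow_succ (2 : ℝ)]; field_simp
    rw [h3]
    have h4 : γ / 2 * ((γ / 2) ^ k * X D 0) ≤ γ / 2 * X (h + 1) (t / L ^ (h + 1)) := by gcongr
    linarith

theorem TreeFlow.le_sum_sub {L D t : ℕ} {κ γ : ℝ} {X X' : ℕ → ℕ → ℝ} (hL : 0 < L) (hD : 0 < D)
    (hX : TreeFlow L D κ γ (t + 1) X) (hX' : TreeFlow L D κ γ (t + 2) X') (hγ : 0 ≤ γ)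
    (hnn : ∀ h y, 0 ≤ X h y) (ht : t + 1 < L ^ D) (heven : Even t)
    (htL : (t + 1) / L = t / L) (hroot : ∀ y < L ^ D, X D y = X' D y) :
    γ / 4 * X 1 (t / L) ≤ ∑ y ∈ Finset.range (L ^ D) with Even y, (X 0 y - X' 0 y) := by
  have hX1 : ∀ y < L ^ D, X 1 y = X' 1 y :=
    hX.eq_of_same_block hL hX' htL hroot (D - 1) 0 (by omega)
  have key : ∀ y < L ^ D, Even y → X 0 y - X' 0 y = γ * if y < t + 1 then
      2 ^ (y % L) * X 1 (y / L) * (1 / (branchDeg L (L ^ D) (t + 1) 0 (y / L) : ℝ) -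
        1 / (branchDeg L (L ^ D) (t + 2) 0 (y / L) : ℝ)) else 0 := by
    intro y hy hye
    have hiff : y < t + 2 ↔ y < t + 1 := by
      have : y ≠ t + 1 := by rintro rfl; exact (Nat.even_add_one.1 hye) heven
      omega
    rw [hX 0 hD y hy, hX' 0 hD y hy, zero_add,
      ← hX1 (y / L) ((Nat.div_le_self _ _).trans_lt hy)]
    simp only [pow_zero, mul_one, hiff]
    split_ifs <;> ring
  have hnonneg : ∀ y ∈ (Finset.range (L ^ D)).filter Even, 0 ≤ X 0 y - X' 0 y := by
    intro y hy
    rw [Finset.mem_filter, Finset.mem_range] at hy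
    rw [key y hy.1 hy.2]
    split_ifs
    · have h1 := branchDeg_pos L (L ^ D) (t + 1) 0 (y / L)
      have h2 := branchDeg_mono L (L ^ D) 0 (y / L) (Nat.le_succ (t + 1))
      have h3 : 1 / (branchDeg L (L ^ D) (t + 2) 0 (y / L) : ℝ) ≤
          1 / (branchDeg L (L ^ D) (t + 1) 0 (y / L) : ℝ) := by gcongr
      have h4 := hnn 1 (y / L)
      exact mul_nonneg hγ (mul_nonneg (by positivity) (by linarith))
    · simp
  refine le_trans ?_ (Finset.single_le_sum hnonneg (a := t) (by simp [heven]; omega))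
  rw [key t (by omega) heven, if_pos (Nat.lt_succ_self t)]
  have h1 := branchDeg_active hL (show t < L ^ D by omega) 0
  have h2 := branchDeg_active hL (show t + 1 < L ^ D by omega) 0
  simp only [zero_add, pow_one, pow_zero, Nat.div_one] at h1 h2
  have hmod : (t + 1) % L = t % L + 1 := by
    have h3 := Nat.div_add_mod t L
    have h4 := Nat.div_add_mod (t + 1) L
    rw [htL] at h4
    omega
  rw [htL, hmod] at h2
  rw [h1, h2]
  apply le_of_eq
  push_cast
  rw [pow_succ, pow_succ]
  field_simp
  ring

/-- The vertices of the lower bound graph: tree nodes `(h, y)`, links between a node and its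
parent, a hub in front of the leaves, a trap, suppliers of mass for the root, and leaves. -/
inductive Vtx (D L s r : ℕ) where
  | node (h : Fin (D + 1)) (y : Fin (L ^ D)) : Vtx D L s r
  | link (h : Fin D) (y : Fin (L ^ D)) (j : Fin (2 ^ L)) : Vtx D L s r
  | hub : Vtx D L s r
  | trap : Vtx D L s r
  | supply (i : Fin s) : Vtx D L s r
  | leaf (i : Fin r) : Vtx D L s r

namespace Vtx

variable {D L s r : ℕ}

/-- The vertex type as a sum type. -/
def equivSum (D L s r : ℕ) : Vtx D L s r ≃
    (Fin (D + 1) × Fin (L ^ D)) ⊕ (Fin D × Fin (L ^ D) × Fin (2 ^ L)) ⊕ Unit ⊕ Unit ⊕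
      Fin s ⊕ Fin r where
  toFun
    | node h y => .inl (h, y)
    | link h y j => .inr (.inl (h, y, j))
    | hub => .inr (.inr (.inl ()))
    | trap => .inr (.inr (.inr (.inl ())))
    | supply i => .inr (.inr (.inr (.inr (.inl i))))
    | leaf i => .inr (.inr (.inr (.inr (.inr i))))
  invFun
    | .inl (h, y) => node h y
    | .inr (.inl (h, y, j)) => link h y j
    | .inr (.inr (.inl ())) => hub
    | .inr (.inr (.inr (.inl ()))) => trap
    | .inr (.inr (.inr (.inr (.inl i)))) => supply i
    | .inr (.inr (.inr (.inr (.inr i)))) => leaf i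
  left_inv v := by cases v <;> rfl
  right_inv v := by rcases v with _ | _ | _ | _ | _ | _ <;> rfl

instance : Fintype (Vtx D L s r) := Fintype.ofEquiv _ (equivSum D L s r).symm

theorem card_eq : Fintype.card (Vtx D L s r) =
    (D + 1) * L ^ D + D * (L ^ D * 2 ^ L) + 2 + s + r := by
  rw [Fintype.card_congr (equivSum D L s r)]
  simp only [Fintype.card_sum, Fintype.card_prod, Fintype.card_fin, Fintype.card_unit]
  ring

theorem sum_eq {M : Type*} [AddCommMonoid M] (f : Vtx D L s r → M) :
    ∑ v, f v = (∑ h, ∑ y, f (node h y)) + ((∑ h, ∑ y, ∑ j, f (link h y j)) +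
      (f hub + (f trap + ((∑ i, f (supply i)) + ∑ i, f (leaf i))))) := by
  rw [← (equivSum D L s r).symm.sum_comp f]
  simp only [Fintype.sum_sum_type, Fintype.sum_prod_type, Fintype.sum_unique]
  rfl

/-- The edges of the lower bound graph at time `τ`. -/
def Adj (τ : ℕ) : Vtx D L s r → Vtx D L s r → Bool
  | node h y, link h' y' j =>
      decide (h = h'.succ ∧ y'.val / L = y.val ∧ y'.val * L ^ h'.val < τ ∧ j.val < 2 ^ (y'.val % L))
  | node h y, hub => decide (h = 0 ∧ Even y.val)
  | node h y, trap => decide (¬ (h = 0 ∧ Even y.val))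
  | link h y _, node h' y' => decide (h' = h.castSucc ∧ y' = y)
  | hub, leaf _ => true
  | trap, trap => true
  | supply _, node h y => decide (h = Fin.last D ∧ y.val = 0)
  | leaf i, leaf i' => decide (i' = i)
  | _, _ => false

/-- The out-degree at time `τ`. -/
def deg (τ : ℕ) (u : Vtx D L s r) : ℕ := ∑ v, if Adj τ u v then 1 else 0

theorem Adj.mono {τ τ' : ℕ} (h : τ ≤ τ') {u v : Vtx D L s r} (ha : Adj τ u v) : Adj τ' u v := by
  cases u <;> cases v <;> simp only [Adj, decide_eq_true_eq] at ha ⊢ <;> first | exact ha | skip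
  exact ⟨ha.1, ha.2.1, ha.2.2.1.trans_le h, ha.2.2.2⟩

theorem deg_link (τ : ℕ) (h : Fin D) (y : Fin (L ^ D)) (j : Fin (2 ^ L)) :
    deg τ (link h y j : Vtx D L s r) = 1 := by
  rw [deg, sum_eq]
  simp [Adj, ite_and]

theorem deg_supply (hL : 0 < L) (τ : ℕ) (i : Fin s) : deg τ (supply i : Vtx D L s r) = 1 := by
  rw [deg, sum_eq]
  have : ∀ y : Fin (L ^ D), y.val = 0 ↔ y = ⟨0, by positivity⟩ := fun y => by rw [Fin.ext_iff]
  simp [Adj, ite_and, this]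

theorem deg_hub (τ : ℕ) : deg τ (hub : Vtx D L s r) = r := by
  rw [deg, sum_eq]
  simp [Adj]

theorem deg_trap (τ : ℕ) : deg τ (trap : Vtx D L s r) = 1 := by
  rw [deg, sum_eq]
  simp [Adj]

theorem deg_leaf (τ : ℕ) (i : Fin r) : deg τ (leaf i : Vtx D L s r) = 1 := by
  rw [deg, sum_eq]
  simp [Adj]

theorem deg_node_zero (τ : ℕ) (y : Fin (L ^ D)) : deg τ (node 0 y : Vtx D L s r) = 1 := by
  rw [deg, sum_eq]
  by_cases hy : Even y.val <;> simp [Adj, hy, (Fin.succ_ne_zero _).symm]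

theorem sum_link_ite {M : Type*} [AddCommMonoid M] (k : ℕ) (hk : k ≤ L) (x : M) :
    (∑ j : Fin (2 ^ L), if j.val < 2 ^ k then x else 0) = 2 ^ k • x := by
  rw [Fin.sum_univ_eq_sum_range (fun j => if j < 2 ^ k then x else 0), ← Finset.sum_filter]
  have : (Finset.range (2 ^ L)).filter (· < 2 ^ k) = Finset.range (2 ^ k) := by
    have := Nat.pow_le_pow_right two_pos hk
    ext j; simp only [Finset.mem_filter, Finset.mem_range]; omega
  rw [this, Finset.sum_const, Finset.card_range]

theorem deg_node_succ (hL : 0 < L) (τ : ℕ) (h : Fin D) (y : Fin (L ^ D)) :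
    deg τ (node h.succ y : Vtx D L s r) = branchDeg L (L ^ D) τ h y := by
  classical
  rw [deg, sum_eq, branchDeg,
    ← Fin.sum_univ_eq_sum_range (fun x => if x / L = y.val ∧ x * L ^ h.val < τ then
      2 ^ (x % L) else 0)]
  have h1 : ∀ y' : Fin (L ^ D), (∑ j : Fin (2 ^ L), if j.val < 2 ^ (y'.val % L) then 1 else 0) =
      2 ^ (y'.val % L) := fun y' => by
    rw [sum_link_ite _ (Nat.mod_lt _ hL).le (1 : ℕ)]; simp
  simp only [Adj, decide_eq_true_eq, Fin.succ_inj, ite_and, Fin.succ_ne_zero]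
  rw [Finset.sum_eq_single h (by intro b _ hb; simp [hb.symm]) (by simp)]
  simp only [if_true, if_false, not_false_eq_true, false_and]
  simp only [Bool.false_eq_true, if_false, Finset.sum_const_zero, add_zero, zero_add]
  rw [add_comm]
  congr 1
  refine Finset.sum_congr rfl fun y' _ => ?_
  split_ifs <;> simp [h1]

theorem one_le_deg (hL : 0 < L) (hr : 0 < r) (τ : ℕ) (u : Vtx D L s r) : 1 ≤ deg τ u := by
  cases u with
  | node h y =>
    induction h using Fin.cases with
    | zero => rw [deg_node_zero]
    | succ h => rw [deg_node_succ hL]; exact branchDeg_pos _ _ _ _ _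
  | link h y j => rw [deg_link]
  | hub => rw [deg_hub]; exact hr
  | trap => rw [deg_trap]
  | supply i => rw [deg_supply hL]
  | leaf i => rw [deg_leaf]

/-- The edges that are determined by their target. -/
def TargetDetermines : Vtx D L s r → Vtx D L s r → Prop
  | node _ _, link _ _ _ => True
  | hub, _ => True
  | _, _ => False

theorem TargetDetermines.left_unique {τ : ℕ} {u u' v : Vtx D L s r} (h : TargetDetermines u v)
    (h' : TargetDetermines u' v) (ha : Adj τ u v) (ha' : Adj τ u' v) : u = u' := by
  cases v <;> cases u <;> simp only [TargetDetermines] at h <;>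
    cases u' <;> simp only [TargetDetermines] at h' <;> simp_all [Adj, Fin.ext_iff]

theorem right_unique_of_not_targetDetermines {τ : ℕ} {u v v' : Vtx D L s r}
    (h : ¬ TargetDetermines u v) (h' : ¬ TargetDetermines u v') (ha : Adj τ u v)
    (ha' : Adj τ u v') : v = v' := by
  cases u <;> cases v <;> simp only [TargetDetermines, not_true] at h <;>
    cases v' <;> simp only [TargetDetermines, not_true] at h' <;> try simp_all [Adj]
  all_goals grind [Adj]

end Vtx

open Vtx

variable {D L s r n : ℕ}

/-- The lower bound graph at time `τ`, transported to `Fin n`. -/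
noncomputable def treeGraph (e : Vtx D L s r ≃ Fin n) (τ : ℕ) : Graph n :=
  Finset.univ.filter fun x => Adj τ (e.symm x.1) (e.symm x.2)

theorem monotone_treeGraph (e : Vtx D L s r ≃ Fin n) : Monotone (treeGraph e) := by
  intro τ τ' h x hx
  simp only [treeGraph, Finset.mem_filter, Finset.mem_univ, true_and] at hx ⊢
  exact Adj.mono h hx

theorem card_treeGraph_le (e : Vtx D L s r ≃ Fin n) (τ : ℕ) : (treeGraph e τ).card ≤ 2 * n := by
  classical
  rw [← Finset.card_filter_add_card_filter_not
    (fun x : Fin n × Fin n => TargetDetermines (e.symm x.1) (e.symm x.2)), two_mul]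
  gcongr
  · refine (Finset.card_le_card_of_injOn Prod.snd (t := Finset.univ) (by simp) ?_).trans (by simp)
    rintro ⟨x, y⟩ hx ⟨x', y'⟩ hx' (rfl : y = y')
    simp only [treeGraph, Finset.coe_filter, Finset.mem_filter, Finset.mem_univ, true_and,
      Set.mem_ofPred_eq] at hx hx'
    rw [e.symm.injective (hx.2.left_unique hx'.2 hx.1 hx'.1)]
  · refine (Finset.card_le_card_of_injOn Prod.fst (t := Finset.univ) (by simp) ?_).trans (by simp)
    rintro ⟨x, y⟩ hx ⟨x', y'⟩ hx' (rfl : x = x')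
    simp only [treeGraph, Finset.coe_filter, Finset.mem_filter, Finset.mem_univ, true_and,
      Set.mem_ofPred_eq] at hx hx'
    rw [e.symm.injective (right_unique_of_not_targetDetermines hx.2 hx'.2 hx.1 hx'.1)]

theorem outDeg_treeGraph (e : Vtx D L s r ≃ Fin n) (τ : ℕ) (u : Vtx D L s r) :
    outDeg (treeGraph e τ) (e u) = deg τ u := by
  classical
  rw [outDeg, deg, ← Finset.card_filter]
  refine Finset.card_bij' (fun x _ => e.symm x.2) (fun v _ => (e u, e v)) ?_ ?_ ?_ ?_
  · rintro ⟨x, y⟩ hx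
    simp only [treeGraph, Finset.mem_filter, Finset.mem_univ, true_and] at hx ⊢
    obtain ⟨h1, rfl⟩ := hx
    simpa using h1
  · intro v hv
    simpa [treeGraph] using hv
  · rintro ⟨x, y⟩ hx
    simp only [Finset.mem_filter] at hx
    simp [hx.2]
  · intro v hv; simp

theorem IsPageRank.treeGraph_apply_eq {ε : ℝ} {e : Vtx D L s r ≃ Fin n} {τ : ℕ} {p : Fin n → ℝ}
    (hp : IsPageRank ε (treeGraph e τ) p) (v : Vtx D L s r) :
    p (e v) = ε / n + (1 - ε) * ∑ u, if Adj τ u v then p (e u) / deg τ u else 0 := by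
  rw [hp.apply_eq, ← e.sum_comp]
  simp only [outDeg_treeGraph]
  simp [treeGraph]

theorem IsPageRank.link_eq (hL : 0 < L) {ε : ℝ} {e : Vtx D L s r ≃ Fin n} {τ : ℕ} {p : Fin n → ℝ}
    (hp : IsPageRank ε (treeGraph e τ) p) (h : Fin D) (y : Fin (L ^ D)) (j : Fin (2 ^ L)) :
    p (e (link h y j)) = ε / n + (1 - ε) * if j.val < 2 ^ (y.val % L) then
      if y.val * L ^ h.val < τ then
        p (e (node h.succ ⟨y / L, (Nat.div_le_self _ _).trans_lt y.2⟩)) /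
          branchDeg L (L ^ D) τ h (y / L) else 0 else 0 := by
  rw [hp.treeGraph_apply_eq, Vtx.sum_eq]
  simp only [Adj, decide_eq_true_eq, ite_and, Finset.sum_const_zero, Bool.false_eq_true, if_false,
    add_zero]
  congr 2
  rw [Finset.sum_eq_single h.succ (by intro b _ hb; simp [hb]) (by simp),
    Finset.sum_eq_single ⟨y / L, (Nat.div_le_self _ _).trans_lt y.2⟩
      (by intro b _ hb; rw [if_pos rfl, if_neg (fun h => hb (Fin.ext h.symm))]) (by simp)]
  rw [deg_node_succ hL, if_pos rfl, if_pos rfl]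
  split_ifs <;> rfl

theorem IsPageRank.node_castSucc_eq {ε : ℝ} {e : Vtx D L s r ≃ Fin n} {τ : ℕ}
    {p : Fin n → ℝ} (hp : IsPageRank ε (treeGraph e τ) p) (h : Fin D) (y : Fin (L ^ D)) :
    p (e (node h.castSucc y)) = ε / n + (1 - ε) * ∑ j, p (e (link h y j)) := by
  rw [hp.treeGraph_apply_eq, Vtx.sum_eq]
  have hne : h.castSucc ≠ Fin.last D := h.castSucc_lt_last.ne
  simp only [Adj, decide_eq_true_eq, ite_and, Finset.sum_const_zero, Bool.false_eq_true, if_false,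
    add_zero, zero_add, Fin.castSucc_inj, hne, deg_link, Nat.cast_one, div_one]
  congr 2
  rw [Finset.sum_eq_single h (by intro b _ hb; simp [hb.symm]) (by simp),
    Finset.sum_eq_single y (by intro b _ hb; simp [hb.symm]) (by simp)]
  simp

theorem IsPageRank.supply_eq {ε : ℝ} {e : Vtx D L s r ≃ Fin n} {τ : ℕ}
    {p : Fin n → ℝ} (hp : IsPageRank ε (treeGraph e τ) p) (i : Fin s) :
    p (e (supply i)) = ε / n := by
  rw [hp.treeGraph_apply_eq, Vtx.sum_eq]
  simp [Adj]

theorem IsPageRank.node_last_eq (hL : 0 < L) {ε : ℝ} {e : Vtx D L s r ≃ Fin n} {τ : ℕ}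
    {p : Fin n → ℝ} (hp : IsPageRank ε (treeGraph e τ) p) (y : Fin (L ^ D)) :
    p (e (node (Fin.last D) y)) =
      ε / n + (1 - ε) * if y.val = 0 then s * (ε / n) else 0 := by
  rw [hp.treeGraph_apply_eq, Vtx.sum_eq]
  have hne : ∀ h : Fin D, ¬ Fin.last D = h.castSucc := fun h => h.castSucc_lt_last.ne'
  simp [Adj, hne, hp.supply_eq, deg_supply hL]

theorem IsPageRank.hub_eq {ε : ℝ} {e : Vtx D L s r ≃ Fin n} {τ : ℕ}
    {p : Fin n → ℝ} (hp : IsPageRank ε (treeGraph e τ) p) :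
    p (e hub) = ε / n + (1 - ε) * ∑ y : Fin (L ^ D), if Even y.val then p (e (node 0 y)) else 0 := by
  rw [hp.treeGraph_apply_eq, Vtx.sum_eq]
  simp only [Adj, decide_eq_true_eq, ite_and, Finset.sum_const_zero, Bool.false_eq_true, if_false,
    add_zero]
  congr 2
  rw [Finset.sum_eq_single 0 (by intro b _ hb; simp [hb]) (by simp)]
  simp [deg_node_zero]

theorem IsPageRank.leaf_eq {ε : ℝ} {e : Vtx D L s r ≃ Fin n} {τ : ℕ}
    {p : Fin n → ℝ} (hp : IsPageRank ε (treeGraph e τ) p) (i : Fin r) :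
    p (e (leaf i)) = ε / n + (1 - ε) * (p (e hub) / r + p (e (leaf i))) := by
  conv_lhs => rw [hp.treeGraph_apply_eq, Vtx.sum_eq]
  simp [Adj, deg_hub, deg_leaf]

/-- The mass of the tree node `(h, y)`. -/
def nodeMass (e : Vtx D L s r ≃ Fin n) (p : Fin n → ℝ) (h y : ℕ) : ℝ :=
  if hy : h < D + 1 ∧ y < L ^ D then p (e (node ⟨h, hy.1⟩ ⟨y, hy.2⟩)) else 0

theorem nodeMass_eq (e : Vtx D L s r ≃ Fin n) (p : Fin n → ℝ) (h : Fin (D + 1)) (y : Fin (L ^ D)) :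
    nodeMass e p h y = p (e (node h y)) := by
  simp [nodeMass, h.2, y.2]

theorem IsPageRank.treeFlow (hL : 0 < L) {ε : ℝ} {e : Vtx D L s r ≃ Fin n} {τ : ℕ}
    {p : Fin n → ℝ} (hp : IsPageRank ε (treeGraph e τ) p) :
    TreeFlow L D (ε / n + (1 - ε) * (2 ^ L * (ε / n))) ((1 - ε) ^ 2) τ (nodeMass e p) := by
  intro h hh y hy
  have h1 := hp.node_castSucc_eq ⟨h, hh⟩ ⟨y, hy⟩
  simp only [hp.link_eq hL] at h1
  rw [← nodeMass_eq e p, ← nodeMass_eq e p, Finset.sum_add_distrib, ← Finset.mul_sum,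
    sum_link_ite _ (Nat.mod_lt _ hL).le] at h1
  simp only [Fin.val_castSucc, Fin.val_succ] at h1
  rw [h1]
  simp only [Finset.sum_const, Finset.card_univ, Fintype.card_fin, nsmul_eq_mul]
  push_cast
  split_ifs <;> ring

theorem IsPageRank.leaf_sub (hL : 0 < L) (hD : 0 < D) {ε : ℝ} (hε0 : 0 < ε) (hε1 : ε < 1)
    (hr : 0 < r) {e : Vtx D L s r ≃ Fin n} {t : ℕ} (ht : t + 1 < L ^ D) (heven : Even t)
    (htL : (t + 1) / L = t / L) {p p' : Fin n → ℝ} (hp : IsPageRank ε (treeGraph e (t + 1)) p)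
    (hp' : IsPageRank ε (treeGraph e (t + 2)) p') (i : Fin r) :
    p' (e (leaf i)) + (1 - ε) ^ 5 * ((1 - ε) ^ 2 / 2) ^ (D - 1) * (s / n) / (4 * r) ≤
      p (e (leaf i)) := by
  have hX := hp.treeFlow hL
  have hX' := hp'.treeFlow hL
  have hroot : ∀ y < L ^ D, nodeMass e p D y = nodeMass e p' D y := by
    intro y hy
    have h1 := nodeMass_eq e p (Fin.last D) ⟨y, hy⟩
    have h2 := nodeMass_eq e p' (Fin.last D) ⟨y, hy⟩
    simp only [Fin.val_last] at h1 h2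
    rw [h1, h2, hp.node_last_eq hL, hp'.node_last_eq hL]
  have hε : 0 < 1 - ε := by linarith
  have hnn : ∀ h y, 0 ≤ nodeMass e p h y := by
    intro h y
    unfold nodeMass
    split_ifs
    · exact hp.1 _
    · rfl
  have h1 := hX.le_sum_sub hL hD hX' (by positivity) hnn ht heven htL hroot
  have h2 := hX.pow_mul_le_active hL (by positivity) (by positivity) (by omega) (D - 1) 1
    (by omega)
  rw [pow_one] at h2
  have h3 : (1 - ε) * (s * (ε / n)) ≤ nodeMass e p D 0 := by
    have h4 := nodeMass_eq e p (Fin.last D) ⟨0, by positivity⟩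
    simp only [Fin.val_last] at h4
    rw [h4, hp.node_last_eq hL, if_pos rfl]
    have : 0 ≤ ε / n := by positivity
    linarith
  have h4 : p (e hub) - p' (e hub) =
      (1 - ε) * ∑ y ∈ Finset.range (L ^ D) with Even y, (nodeMass e p 0 y - nodeMass e p' 0 y) := by
    rw [hp.hub_eq, hp'.hub_eq, Finset.sum_filter, ← Fin.sum_univ_eq_sum_range (fun y =>
      if Even y then nodeMass e p 0 y - nodeMass e p' 0 y else 0)]
    have h5 : ∀ (q : Fin n → ℝ) (y : Fin (L ^ D)), nodeMass e q 0 y = q (e (node 0 y)) :=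
      fun q y => nodeMass_eq e q 0 y
    simp only [h5]
    rw [add_sub_add_left_eq_sub, ← mul_sub, ← Finset.sum_sub_distrib]
    congr 2
    ext y
    split_ifs <;> simp
  have h5 : (1 - ε) * ((1 - ε) ^ 2 / 4 *
      (((1 - ε) ^ 2 / 2) ^ (D - 1) * ((1 - ε) * (s * (ε / n))))) ≤ p (e hub) - p' (e hub) := by
    rw [h4]
    refine mul_le_mul_of_nonneg_left (le_trans ?_ h1) hε.le
    refine mul_le_mul_of_nonneg_left (le_trans ?_ h2) (by positivity)
    exact mul_le_mul_of_nonneg_left h3 (by positivity)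
  have h6 := hp.leaf_eq i
  have h7 := hp'.leaf_eq i
  have hr' : (0 : ℝ) < r := by exact_mod_cast hr
  have h8 : ε * (p (e (leaf i)) - p' (e (leaf i))) =
      (1 - ε) / r * (p (e hub) - p' (e hub)) := by
    have h9 : (1 - ε) / r * (p (e hub) - p' (e hub)) =
      (1 - ε) * (p (e hub) / r) - (1 - ε) * (p' (e hub) / r) := by ring
    rw [h9]
    linear_combination h6 - h7
  have h9 := mul_le_mul_of_nonneg_left h5 (show 0 ≤ (1 - ε) / r by positivity)
  rw [← h8] at h9
  have h10 : (1 - ε) / r * ((1 - ε) * ((1 - ε) ^ 2 / 4 *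
      (((1 - ε) ^ 2 / 2) ^ (D - 1) * ((1 - ε) * (s * (ε / n)))))) =
      ε * ((1 - ε) ^ 5 * ((1 - ε) ^ 2 / 2) ^ (D - 1) * (s / n) / (4 * r)) := by
    field_simp
  rw [h10] at h9
  have h11 := le_of_mul_le_mul_left h9 hε0
  linarith

theorem sum_range_two_mul_odd (K R : ℕ) :
    ∑ t ∈ Finset.range (2 * K), (if Odd t then R else 0) = K * R := by
  induction K with
  | zero => simp
  | succ K ih =>
    rw [mul_add, mul_one, Finset.sum_range_succ, Finset.sum_range_succ, ih,
      if_neg (Nat.not_odd_iff_even.2 (even_two_mul K)), if_pos (odd_two_mul_add_one K)]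
    ring

theorem le_diffCount_treeGraph {D L s R n : ℕ} {ε α : ℝ} (hε0 : 0 < ε) (hε1 : ε < 1) (hL : 0 < L)
    (hLe : Even L) (hD : 0 < D) (hR : 0 < R)
    (hα : 4 * α < (1 - ε) ^ 5 * ((1 - ε) ^ 2 / 2) ^ (D - 1) * (s / n) / 4)
    (e : Vtx D L s (2 * R) ≃ Fin n) (t : ℕ) (ht : t < L ^ D) (q q' : Fin n → ℝ)
    (hq : IsAdditiveApprox ε α (treeGraph e t) q)
    (hq' : IsAdditiveApprox ε α (treeGraph e (t + 1)) q') :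
    (if Odd t then R else 0) ≤ diffCount q q' := by
  classical
  split_ifs with hodd
  swap
  · exact Nat.zero_le _
  obtain ⟨t, rfl⟩ : ∃ t', t = t' + 1 := ⟨t - 1, by have := hodd.pos; omega⟩
  have heven : Even t := by
    rw [← Nat.not_odd_iff_even]; intro h; exact (Nat.odd_add_one.1 hodd) h
  have htL : (t + 1) / L = t / L := by
    rw [Nat.succ_div_of_not_dvd]
    intro hdvd
    exact Nat.not_even_iff_odd.2 hodd (even_iff_two_dvd.2 (hLe.two_dvd.trans hdvd))
  have hcard : ((Finset.univ : Finset (Fin (2 * R))).image fun i => e (leaf i)).card = 2 * R := by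
    rw [Finset.card_image_of_injective _ fun i j h => by simpa using h]
    simp
  have hε : 0 < 1 - ε := by linarith
  have hR' : (0 : ℝ) < R := by exact_mod_cast hR
  refine le_diffCount_of_forall_add_le
    (δ := (1 - ε) ^ 5 * ((1 - ε) ^ 2 / 2) ^ (D - 1) * (s / n) / (4 * (2 * R : ℕ)))
    ((Finset.univ : Finset (Fin (2 * R))).image fun i => e (leaf i)) R hcard.symm
    (by positivity) ?_ ?_ hq hq'
  · rw [hcard]
    refine hα.trans_eq ?_
    push_cast
    field_simp
  · intro p p' hp hp' v hv
    simp only [Finset.mem_image, Finset.mem_univ, true_and] at hv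
    obtain ⟨i, rfl⟩ := hv
    exact hp.leaf_sub hL hD hε0 hε1 (by omega) ht heven htL hp' i

theorem exists_hard_instance {D L s R n K : ℕ} {ε α : ℝ} (hε0 : 0 < ε) (hε1 : ε < 1) (hL : 0 < L)
    (hLe : Even L) (hD : 0 < D) (hR : 0 < R) (hK : L ^ D = 2 * K)
    (hα : 4 * α < (1 - ε) ^ 5 * ((1 - ε) ^ 2 / 2) ^ (D - 1) * (s / n) / 4)
    (hn : (D + 1) * L ^ D + D * (L ^ D * 2 ^ L) + 2 + s + 2 * R = n) :
    ∃ (G₀ : Graph n) (es : List (Fin n × Fin n)),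
      (∀ v, 1 ≤ outDeg G₀ v) ∧ es.Nodup ∧ (∀ e ∈ es, e ∉ G₀) ∧ G₀.card + es.length ≤ 2 * n ∧
      (∀ (A : Algorithm n) (T : ℕ),
        A.MaintainsInTime ε α G₀ (es.map Update.ins) T → K * R ≤ T) ∧
      (∀ (A : Algorithm n) (T : ℕ),
        A.MaintainsInTime ε α (G₀ ∪ es.toFinset) (es.reverse.map Update.del) T → K * R ≤ T) := by
  let e : Vtx D L s (2 * R) ≃ Fin n :=
    Fintype.equivFinOfCardEq (by rw [Vtx.card_eq, hn])
  have hG := monotone_treeGraph e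
  have hdiff := le_diffCount_treeGraph hε0 hε1 hL hLe hD hR hα e
  have hsub : treeGraph e 0 ⊆ treeGraph e (L ^ D) := hG (Nat.zero_le _)
  have hnodup := nodup_edgeSeq hG (L ^ D)
  have hfin := toFinset_edgeSeq hG (L ^ D)
  refine ⟨treeGraph e 0, edgeSeq (treeGraph e) (L ^ D), fun v => ?_, hnodup, fun x hx => ?_, ?_,
    fun A T h => ?_, fun A T h => ?_⟩
  · obtain ⟨u, rfl⟩ := e.surjective v
    rw [outDeg_treeGraph]
    exact one_le_deg hL (by omega) _ _
  · rw [← List.mem_toFinset, hfin] at hx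
    exact (Finset.mem_sdiff.1 hx).2
  · rw [← List.toFinset_card_of_nodup hnodup, hfin, add_comm,
      Finset.card_sdiff_add_card_eq_card hsub]
    exact card_treeGraph_le e _
  · rw [Algorithm.MaintainsInTime, edgeSeq, List.range_eq_range'] at h
    have h1 := sum_le_of_maintains_insertions hG _ _ hdiff 0 (zero_add _) h
    rwa [← Finset.range_eq_Ico, hK, sum_range_two_mul_odd] at h1
  · rw [Algorithm.MaintainsInTime, hfin, Finset.union_sdiff_of_subset hsub] at h
    have h1 := sum_le_of_maintains_deletions hG _ hdiff h
    rwa [hK, sum_range_two_mul_odd] at h1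

/-- The depth of the tree for which the mass of the leaves moves by more than the error `a`. -/
noncomputable def treeDepth (ε a : ℝ) : ℕ := ⌊Real.log ((1 - ε) ^ 6 / (101 * a)) / 10⌋₊ + 1

section treeDepth

variable {ε a : ℝ} (hε0 : 0.01 < ε) (hε1 : ε < 0.99) (ha0 : 0 < a) (ha1 : a ≤ (1 - ε) ^ 6 / 101)

include ha0 ha1 in
theorem treeDepth_log_nonneg : 0 ≤ Real.log ((1 - ε) ^ 6 / (101 * a)) := by
  apply Real.log_nonneg
  rw [one_le_div (by positivity)]
  linarith

include hε0 hε1 ha0 ha1 in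
theorem treeDepth_sub_one_le : ((treeDepth ε a - 1 : ℕ) : ℝ) ≤ Real.log (1 / a) / 10 := by
  have h0 := treeDepth_log_nonneg ha0 ha1
  rw [treeDepth, Nat.add_sub_cancel]
  refine (Nat.floor_le (by positivity)).trans ?_
  have hε : 0 < 1 - ε := by linarith
  have h1 : (1 - ε) ^ 6 ≤ 1 := pow_le_one₀ hε.le (by linarith)
  gcongr ?_ / 10
  apply Real.log_le_log (by positivity)
  gcongr
  linarith

include hε1 ha0 in
theorem log_le_mul_treeDepth : Real.log (1 / a) ≤ 43 * treeDepth ε a := by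
  have hε : 0.01 < 1 - ε := by linarith
  have hε' : 0 < 1 - ε := by linarith
  have h1 : Real.log ((1 - ε) ^ 6 / (101 * a)) / 10 ≤ treeDepth ε a := by
    rw [treeDepth]; push_cast; exact (Nat.lt_floor_add_one _).le
  have h2 : 1 / a = (1 - ε) ^ 6 / (101 * a) * (101 / (1 - ε) ^ 6) := by field_simp
  rw [h2, Real.log_mul (by positivity) (by positivity)]
  have h3 : Real.log (101 / (1 - ε) ^ 6) ≤ 33 := by
    rw [Real.log_le_iff_le_exp (by positivity)]
    have h4 : (0.01 : ℝ) ^ 6 ≤ (1 - ε) ^ 6 := by gcongr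
    have h5 : 101 / (1 - ε) ^ 6 ≤ 101 / (0.01 : ℝ) ^ 6 := by gcongr
    have h6 : (2.7 : ℝ) ^ 33 ≤ Real.exp 1 ^ 33 := by
      gcongr; have := Real.exp_one_gt_d9; linarith
    rw [← Real.exp_nat_mul] at h6
    norm_num at h5 h6 ⊢
    linarith
  have h4 : (1 : ℝ) ≤ treeDepth ε a := by exact_mod_cast Nat.succ_pos _
  linarith

include hε0 hε1 ha0 ha1 in
theorem four_mul_lt_of_treeDepth {x : ℝ} (hx : 1 / 2 ≤ x) :
    4 * a < (1 - ε) ^ 5 * ((1 - ε) ^ 2 / 2) ^ (treeDepth ε a - 1) * x / 4 := by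
  have hε : 0.01 < 1 - ε := by linarith
  have hε' : 0 < 1 - ε := by linarith
  have h0 := treeDepth_log_nonneg ha0 ha1
  set k := treeDepth ε a - 1 with hk
  have hkle : (k : ℝ) * 10 ≤ Real.log ((1 - ε) ^ 6 / (101 * a)) := by
    have := Nat.floor_le (show 0 ≤ Real.log ((1 - ε) ^ 6 / (101 * a)) / 10 by positivity)
    rw [hk, treeDepth, Nat.add_sub_cancel]
    linarith
  have hq : Real.exp (-10) ≤ (1 - ε) ^ 2 / 2 := by
    have h1 : (0.01 : ℝ) ^ 2 ≤ (1 - ε) ^ 2 := by gcongr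
    have h6 : (2.7 : ℝ) ^ 10 ≤ Real.exp 1 ^ 10 := by
      gcongr; have := Real.exp_one_gt_d9; linarith
    rw [← Real.exp_nat_mul] at h6
    have h7 : Real.exp (-10) ≤ 1 / 20000 := by
      rw [Real.exp_neg, ← one_div]
      gcongr
      norm_num at h6
      linarith
    norm_num at h1
    linarith
  have hpow : 101 * a / (1 - ε) ^ 6 ≤ ((1 - ε) ^ 2 / 2) ^ k := by
    calc 101 * a / (1 - ε) ^ 6 = Real.exp (-Real.log ((1 - ε) ^ 6 / (101 * a))) := by
          rw [Real.exp_neg, Real.exp_log (by positivity), inv_div]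
      _ ≤ Real.exp (k * (-10)) := by gcongr; linarith
      _ = Real.exp (-10) ^ k := Real.exp_nat_mul _ _
      _ ≤ _ := by gcongr
  calc 4 * a < (1 - ε) ^ 5 * (101 * a / (1 - ε) ^ 6) * (1 / 2) / 4 := by
        have : (1 - ε) ^ 5 * (101 * a / (1 - ε) ^ 6) * (1 / 2) / 4 = 101 / 8 * (a / (1 - ε)) := by
          field_simp; ring
        rw [this]
        have : a ≤ a / (1 - ε) := by rw [le_div_iff₀ hε']; nlinarith
        linarith
    _ ≤ _ := by gcongr

end treeDepth

/-- The branching number of the tree. -/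
def branching (n : ℕ) : ℕ := 2 * (Nat.log 2 n / 4)

theorem two_pow_branching_le {n : ℕ} (hn : n ≠ 0) :
    (2 : ℝ) ^ branching n ≤ (n : ℝ) ^ (1 / 2 : ℝ) := by
  have h1 : (2 ^ branching n) ^ 2 ≤ n := by
    rw [← pow_mul]
    refine le_trans (Nat.pow_le_pow_right two_pos ?_) (Nat.pow_log_le_self 2 hn)
    unfold branching; omega
  rw [← Real.sqrt_eq_rpow]
  apply Real.le_sqrt_of_sq_le
  exact_mod_cast h1

theorem branching_le_log {n : ℕ} (hn : n ≠ 0) : (branching n : ℝ) ≤ Real.log n := by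
  have h1 : (2 : ℝ) ^ (2 * branching n) ≤ n := by
    have : 2 ^ (2 * branching n) ≤ n := by
      refine le_trans (Nat.pow_le_pow_right two_pos ?_) (Nat.pow_log_le_self 2 hn)
      unfold branching; omega
    exact_mod_cast this
  have h2 := Real.log_le_log (by positivity) h1
  rw [Real.log_pow] at h2
  push_cast at h2
  have h3 := Real.log_two_gt_d9
  have h4 : (0 : ℝ) ≤ branching n := Nat.cast_nonneg _
  nlinarith

theorem le_branching {n : ℕ} (hn : n ≠ 0) : Real.log n / 2 - 3 ≤ branching n := by
  have h1 : (n : ℝ) ≤ 2 ^ (Nat.log 2 n + 1) := by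
    exact_mod_cast (Nat.lt_pow_succ_log_self one_lt_two n).le
  have h2 := Real.log_le_log (by positivity) h1
  rw [Real.log_pow] at h2
  have h3 := Real.log_two_lt_d9
  have h4 : Nat.log 2 n ≤ 2 * branching n + 4 := by unfold branching; omega
  have h5 : (Nat.log 2 n : ℝ) ≤ 2 * branching n + 4 := by exact_mod_cast h4
  have h6 : ((Nat.log 2 n + 1 : ℕ) : ℝ) * Real.log 2 ≤ ((Nat.log 2 n + 1 : ℕ) : ℝ) * 1 := by
    gcongr; linarith
  push_cast at h6 h2
  linarith

theorem tree_size_le {n D : ℕ} {x : ℝ} (hl : 2 ≤ Real.log n)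
    (hll : 1 ≤ Real.log (Real.log n)) (hx0 : 0 ≤ x) (hx : x * Real.log (Real.log n) ≤ Real.log n)
    (hD : 0 < D) (hDx : ((D - 1 : ℕ) : ℝ) ≤ x / 10)
    (hbig : 32 * Real.log n ^ 2 * (n : ℝ) ^ (6 / 10 : ℝ) ≤ n) :
    (((D + 1) * branching n ^ D + D * (branching n ^ D * 2 ^ branching n) : ℕ) : ℝ) ≤ n / 8 := by
  have hn : n ≠ 0 := by rintro rfl; norm_num at hl
  have hn' : (0 : ℝ) < n := by positivity
  obtain ⟨k, rfl⟩ : ∃ k, D = k + 1 := ⟨D - 1, by omega⟩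
  rw [Nat.add_sub_cancel] at hDx
  have hl0 : 0 < Real.log n := by linarith
  have hxl : x ≤ Real.log n := by nlinarith
  have h1 : (k : ℝ) + 2 ≤ 2 * Real.log n := by linarith
  have h2 := two_pow_branching_le hn
  have h3 : (branching n : ℝ) ^ (k + 1) ≤ Real.log n * (n : ℝ) ^ (1 / 10 : ℝ) := by
    calc (branching n : ℝ) ^ (k + 1) ≤ Real.log n ^ (k + 1) := by
          gcongr; exact branching_le_log hn
      _ = Real.log n * Real.exp (k * Real.log (Real.log n)) := by
          rw [Real.exp_nat_mul, Real.exp_log hl0]; ring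
      _ ≤ Real.log n * Real.exp (Real.log n * (1 / 10)) := by
          have : k * Real.log (Real.log n) ≤ x / 10 * Real.log (Real.log n) := by gcongr
          exact mul_le_mul_of_nonneg_left (Real.exp_le_exp.2 (by linarith)) hl0.le
      _ = _ := by rw [Real.rpow_def_of_pos hn']
  have h4 : (1 : ℝ) ≤ 2 ^ branching n := one_le_pow₀ (by norm_num)
  push_cast
  calc _ ≤ 2 * ((k : ℝ) + 2) * ((branching n : ℝ) ^ (k + 1) * 2 ^ branching n) := by
        have h5 : (0 : ℝ) ≤ (branching n : ℝ) ^ (k + 1) := by positivity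
        have h6 : (branching n : ℝ) ^ (k + 1) ≤ (branching n : ℝ) ^ (k + 1) * 2 ^ branching n :=
          le_mul_of_one_le_right h5 h4
        have h7 : ((k : ℝ) + 2) * (branching n : ℝ) ^ (k + 1) ≤
          ((k : ℝ) + 2) * ((branching n : ℝ) ^ (k + 1) * 2 ^ branching n) := by gcongr
        nlinarith [mul_nonneg h5 (zero_le_one.trans h4)]
    _ ≤ 2 * (2 * Real.log n) * (Real.log n * (n : ℝ) ^ (1 / 10 : ℝ) * (n : ℝ) ^ (1 / 2 : ℝ)) := by
        gcongr
    _ = 4 * Real.log n ^ 2 * (n : ℝ) ^ (6 / 10 : ℝ) := by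
        rw [mul_assoc (Real.log n), ← Real.rpow_add hn']; norm_num; ring
    _ ≤ n / 8 := by linarith

theorem rpow_le_of_branching {n D : ℕ} {a : ℝ} (ha : 0 < a) (hl : 2 ≤ Real.log n)
    (hll : 1 ≤ Real.log (Real.log n)) (hD : 0 < D) (hx : Real.log (1 / a) ≤ 43 * D)
    (hL : 32 * Real.sqrt (Real.log n) ≤ branching n) :
    32 * (1 / a) ^ (1 / 86 * Real.log (Real.log n)) ≤ (branching n : ℝ) ^ D := by
  have hl0 : 0 < Real.log n := by linarith
  calc 32 * (1 / a) ^ (1 / 86 * Real.log (Real.log n))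
      = 32 * Real.exp (Real.log (1 / a) * (1 / 86 * Real.log (Real.log n))) := by
        rw [Real.rpow_def_of_pos (by positivity)]
    _ ≤ 32 * Real.exp (43 * D * (1 / 86 * Real.log (Real.log n))) := by gcongr
    _ = 32 * Real.exp (D * (Real.log (Real.log n) * (1 / 2))) := by congr 2; ring
    _ = 32 * Real.sqrt (Real.log n) ^ D := by
        rw [Real.exp_nat_mul, Real.sqrt_eq_rpow, Real.rpow_def_of_pos hl0]
    _ ≤ 32 ^ D * Real.sqrt (Real.log n) ^ D := by
        gcongr; exact le_self_pow₀ (by norm_num) hD.ne'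
    _ = (32 * Real.sqrt (Real.log n)) ^ D := (mul_pow _ _ _).symm
    _ ≤ _ := by gcongr

theorem exists_hard_instance_of_large {n : ℕ} {ε a : ℝ} (hε0 : 0.01 < ε) (hε1 : ε < 0.99)
    (ha0 : 0 < a) (ha1 : a ≤ (1 - ε) ^ 6 / 101) (hn : 64 ≤ n) (hl : 2 ≤ Real.log n)
    (hll : 1 ≤ Real.log (Real.log n))
    (hx : Real.log (1 / a) * Real.log (Real.log n) ≤ Real.log n)
    (hbig : 32 * Real.log n ^ 2 * (n : ℝ) ^ (6 / 10 : ℝ) ≤ n)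
    (hL : 32 * Real.sqrt (Real.log n) ≤ branching n) :
    ∃ (G₀ : Graph n) (es : List (Fin n × Fin n)),
      (∀ v, 1 ≤ outDeg G₀ v) ∧ es.Nodup ∧ (∀ e ∈ es, e ∉ G₀) ∧
      (G₀.card : ℝ) + es.length ≤ 2 * n ∧
      (∀ (A : Algorithm n) (T : ℕ), A.MaintainsInTime ε a G₀ (es.map Update.ins) T →
        (n : ℝ) * (1 / a) ^ (1 / 86 * Real.log (Real.log n)) ≤ T) ∧
      (∀ (A : Algorithm n) (T : ℕ),
        A.MaintainsInTime ε a (G₀ ∪ es.toFinset) (es.reverse.map Update.del) T →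
        (n : ℝ) * (1 / a) ^ (1 / 86 * Real.log (Real.log n)) ≤ T) := by
  set D := treeDepth ε a with hDdef
  set L := branching n with hLdef
  have hD : 0 < D := Nat.succ_pos _
  have hL0 : 0 < L := by
    have h1 : 0 < Real.sqrt (Real.log n) := Real.sqrt_pos.2 (by linarith)
    have : (0 : ℝ) < L := by linarith
    exact_mod_cast this
  have hLe : Even L := even_two_mul _
  obtain ⟨K, hK⟩ : ∃ K, L ^ D = 2 * K := (hLe.pow_of_ne_zero hD.ne').two_dvd
  have hx0 : 0 ≤ Real.log (1 / a) := by
    apply Real.log_nonneg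
    rw [one_le_div ha0]
    have : (1 - ε) ^ 6 ≤ 1 := pow_le_one₀ (by linarith) (by linarith)
    linarith
  have htree := tree_size_le hl hll hx0 hx hD (treeDepth_sub_one_le hε0 hε1 ha0 ha1) hbig
  set N := (D + 1) * L ^ D + D * (L ^ D * 2 ^ L) with hN
  have hN8 : 8 * N ≤ n := by
    have : 8 * (N : ℝ) ≤ n := by linarith
    exact_mod_cast this
  obtain ⟨s, hs⟩ : ∃ s, N + 2 + s + 2 * (n / 8) = n := ⟨n - N - 2 - 2 * (n / 8), by omega⟩
  have hs2 : n ≤ 2 * s := by omega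
  have hn0 : (0 : ℝ) < n := Nat.cast_pos.2 (by omega)
  have hsn : 1 / 2 ≤ (s : ℝ) / n := by
    rw [le_div_iff₀ hn0]
    have : (n : ℝ) ≤ 2 * s := by exact_mod_cast hs2
    linarith
  obtain ⟨G₀, es, h1, h2, h3, h4, h5, h6⟩ :=
    exists_hard_instance (by linarith) (by linarith) hL0 hLe hD (show 0 < n / 8 by omega) hK
      (four_mul_lt_of_treeDepth hε0 hε1 ha0 ha1 hsn) hs
  have hKR : (n : ℝ) * (1 / a) ^ (1 / 86 * Real.log (Real.log n)) ≤ ((K * (n / 8) : ℕ) : ℝ) := by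
    have h7 := rpow_le_of_branching ha0 hl hll hD (log_le_mul_treeDepth hε1 ha0) hL
    have h8 : (branching n : ℝ) ^ D = 2 * K := by exact_mod_cast hK
    have h9 : (n : ℝ) ≤ 16 * (n / 8 : ℕ) := by
      have : n ≤ 16 * (n / 8) := by omega
      exact_mod_cast this
    rw [h8] at h7
    push_cast
    calc (n : ℝ) * (1 / a) ^ (1 / 86 * Real.log (Real.log n)) ≤
          16 * (n / 8 : ℕ) * (K / 16) := by
          gcongr
          linarith
      _ = _ := by ring
  exact ⟨G₀, es, h1, h2, h3, by exact_mod_cast h4,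
    fun A T h => hKR.trans (by exact_mod_cast h5 A T h),
    fun A T h => hKR.trans (by exact_mod_cast h6 A T h)⟩

theorem eventually_sqrt_log_le_branching :
    ∀ᶠ n : ℕ in atTop, 32 * Real.sqrt (Real.log n) ≤ branching n := by
  have hlog : Tendsto (fun n : ℕ => Real.log n) atTop atTop :=
    Real.tendsto_log_atTop.comp tendsto_natCast_atTop_atTop
  filter_upwards [hlog.eventually_ge_atTop 10000, eventually_ne_atTop 0] with n h1 h2
  refine le_trans ?_ (le_branching h2)
  have h3 := Real.sq_sqrt (show 0 ≤ Real.log n by linarith)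
  have h4 : 100 ≤ Real.sqrt (Real.log n) := Real.le_sqrt_of_sq_le (by linarith)
  nlinarith

theorem eventually_log_sq_mul_rpow_le :
    ∀ᶠ n : ℕ in atTop, 32 * Real.log n ^ 2 * (n : ℝ) ^ (6 / 10 : ℝ) ≤ n := by
  have h := (isLittleO_log_rpow_rpow_atTop (s := 4 / 10) 2 (by norm_num)).bound
    (show (0 : ℝ) < 1 / 32 by norm_num)
  filter_upwards [tendsto_natCast_atTop_atTop.eventually h, eventually_gt_atTop 0] with n h1 h2
  have hn : (0 : ℝ) < n := by exact_mod_cast h2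
  rw [Real.rpow_two, Real.norm_of_nonneg (by positivity), Real.norm_of_nonneg (by positivity)] at h1
  calc 32 * Real.log n ^ 2 * (n : ℝ) ^ (6 / 10 : ℝ) ≤
        (n : ℝ) ^ (4 / 10 : ℝ) * (n : ℝ) ^ (6 / 10 : ℝ) := by gcongr; linarith
    _ = n := by rw [← Real.rpow_add hn]; norm_num

end DynPageRank

theorem mainTheorem2 :
    ∃ c C : ℝ, 0 < c ∧ ∀ ε : ℝ, 0.01 < ε → ε < 0.99 →
      ∀ α : ℕ → ℝ,
        (∀ᶠ n in atTop, 0 < α n ∧ α n ≤ (1 - ε) ^ 6 / 101) →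
        (∃ g : ℕ → ℝ, (g =o[atTop] fun n : ℕ => 1 / Real.log (Real.log n)) ∧
          ∀ᶠ n : ℕ in atTop, 1 / α n = (n : ℝ) ^ g n) →
        ∀ᶠ n : ℕ in atTop,
          ∃ (G₀ : DynPageRank.Graph n) (es : List (Fin n × Fin n)),
            (∀ v, 1 ≤ DynPageRank.outDeg G₀ v) ∧
            es.Nodup ∧ (∀ e ∈ es, e ∉ G₀) ∧
            (G₀.card : ℝ) + es.length ≤ C * n ∧
            (∀ (A : DynPageRank.Algorithm n) (T : ℕ),
              A.MaintainsInTime ε (α n) G₀ (es.map DynPageRank.Update.ins) T →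
                (n : ℝ) * (1 / α n) ^ (c * Real.log (Real.log n)) ≤ T) ∧
            (∀ (A : DynPageRank.Algorithm n) (T : ℕ),
              A.MaintainsInTime ε (α n) (G₀ ∪ es.toFinset)
                  (es.reverse.map DynPageRank.Update.del) T →
                (n : ℝ) * (1 / α n) ^ (c * Real.log (Real.log n)) ≤ T) := by
  refine ⟨1 / 86, 2, by norm_num, fun ε hε0 hε1 α hα ⟨g, hg, hαg⟩ => ?_⟩
  have hlog : Tendsto (fun n : ℕ => Real.log n) atTop atTop :=
    Real.tendsto_log_atTop.comp tendsto_natCast_atTop_atTop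
  have hloglog : Tendsto (fun n : ℕ => Real.log (Real.log n)) atTop atTop :=
    Real.tendsto_log_atTop.comp hlog
  filter_upwards [hα, hαg, hg.bound one_pos, eventually_ge_atTop 64, hlog.eventually_ge_atTop 2,
    hloglog.eventually_ge_atTop 1, DynPageRank.eventually_log_sq_mul_rpow_le,
    DynPageRank.eventually_sqrt_log_le_branching] with n h1 h2 h3 h4 h5 h6 h7 h8
  refine DynPageRank.exists_hard_instance_of_large hε0 hε1 h1.1 h1.2 h4 h5 h6 ?_ h7 h8
  have hn : (0 : ℝ) < n := by positivity
  rw [h2, Real.log_rpow hn]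
  rw [one_mul, Real.norm_eq_abs, Real.norm_eq_abs, abs_of_nonneg (a := 1 / _) (by positivity),
    le_div_iff₀ (by linarith)] at h3
  have h9 : g n * Real.log (Real.log n) ≤ 1 :=
    le_trans (by gcongr; exact le_abs_self _) h3
  nlinarith
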